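/- Let $\mathbb{D}$ be the open unit ball of the quaternions $\mathbb{H}$ and let $\mathbb{S}=\{i\in\mathbb{H}: \operatorname{Re} i=0,\ |i|=1\}$. A real differentiable function $f:\mathbb{D}\to\mathbb{H}$ is called left slice hyperholomorphic if $f(a+ib)=\alpha(a,b)+i\beta(a,b)$ for all $i\in\mathbb{S}$ and all real $a,b$ with $a+ib\in\mathbb{D}$, where $\alpha,\beta$ are $\mathbb{H}$-valued functions with $\alpha(a,-b)=\alpha(a,b)$, $\beta(a,-b)=-\beta(a,b)$, $\partial_a\alpha=\partial_b\beta$ and $\partial_a\beta=-\partial_b\alpha$. Let $\mathcal{H}$ be a quaternionic right Hilbert space (with scalar product $\langle\cdot,\cdot\rangle$ right linear in the second argument) whose elements are left slice hyperholomorphic functions on $\mathbb{D}$, with pointwise operations, such that each point evaluation $f\mapsto f(w)$, $w\in\mathbb{D}$, is bounded on $\mathcal{H}$, and such that for each $q\in\mathbb{D}$ there is $f\in\mathcal{H}$ with $f(q)\neq 0$. Let $K_w\in\mathcal{H}$ be the reproducing kernel function, $f(w)=\langle K_w,f\rangle$ for all $f\in\mathcal{H}$, put $K(q,w)=K_w(q)$,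 and let $k_q=K_q/\sqrt{K(q,q)}$. Fix $i\in\mathbb{S}$, put $\mathbb{C}_i=\{a+ib: a,b\in\mathbb{R}\}$ and $\mathbb{D}_i=\mathbb{D}\cap\mathbb{C}_i$, and let $J$ be a bounded right linear operator on $\mathcal{H}$ that is unitary and anti-selfadjoint and satisfies $$\{x\in\mathcal{H}: Jx=xi\}=\overline{\operatorname{span}_{\mathbb{C}_i}\{K_q: q\in\mathbb{D}_i\}}$$ (right linear span over $\mathbb{C}_i$). Let $\mathcal{B}_J(\mathcal{H})$ be the set of all bounded right linear operators $T$ on $\mathcal{H}$ with $TJ=JT$, and for $T\in\mathcal{B}_J(\mathcal{H})$ let $\widetilde T:\mathbb{D}_i\to\mathbb{H}$, $\widetilde T(q)=\langle k_q,Tk_q\rangle$, be its Berezin transform. Then the Berezin transform $T\mapsto\widetilde T$ is one-to-one on $\mathcal{B}_J(\mathcal{H})$: if $T,S\in\mathcal{B}_J(\mathcal{H})$ and $\widetilde T(q)=\widetilde S(q)$ for all $q\in\mathbb{D}_i$, then $T=S$. -/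

import Mathlib

open Quaternion MulOpposite

namespace QuaternionicBerezin

/-- The sphere `𝕊` of imaginary units of the quaternions. -/
def imagUnits : Set ℍ := {i | i.re = 0 ∧ ‖i‖ = 1}

/-- The complex plane `ℂ_i = {a + i b : a, b real}` in the quaternions. -/
def slicePlane (i : ℍ) : Set ℍ := {x | ∃ a b : ℝ, x = (a : ℍ) + i * (b : ℍ)}

/-- The open unit ball `𝔻` of the quaternions. -/
def unitBall : Set ℍ := Metric.ball 0 1

/-- Left slice hyperholomorphic functions on an axially symmetric open set `U` of quaternions:
real differentiable functions of the form `f (a + i b) = α (a, b) + i β (a, b)`, for all imaginary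
units `i`, where `α` is even and `β` is odd in `b`, and `α, β` satisfy the Cauchy-Riemann system
on the planar set `{(a, b) : a + i b ∈ U}` (which does not depend on `i`). The functions
`F, α, β` are only relevant on `U`, respectively on this planar set. -/
def IsLeftSliceHyperholomorphic {U : Set ℍ} (f : U → ℍ) : Prop :=
  (∃ F : ℍ → ℍ, (∀ x : U, F x = f x) ∧ DifferentiableOn ℝ F U) ∧
  ∃ α β : ℝ × ℝ → ℍ,
    (∀ i ∈ imagUnits, ∀ a b : ℝ, ∀ h : (a : ℍ) + i * (b : ℍ) ∈ U,
      f ⟨(a : ℍ) + i * (b : ℍ), h⟩ = α (a, b) + i * β (a, b)) ∧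
    (∀ i ∈ imagUnits, ∀ a b : ℝ, (a : ℍ) + i * (b : ℍ) ∈ U →
      α (a, -b) = α (a, b) ∧ β (a, -b) = -β (a, b) ∧
      DifferentiableAt ℝ α (a, b) ∧ DifferentiableAt ℝ β (a, b) ∧
      deriv (fun s => α (s, b)) a = deriv (fun t => β (a, t)) b ∧
      deriv (fun s => β (s, b)) a = -deriv (fun t => α (a, t)) b)

/-- Quaternionic (right) Hilbert spaces. The right scalar multiplication `x a` is the action
`op a • x`; the scalar product is right linear in its second argument and the norm of the space
is `√⟨x, x⟩`. -/
class QuaternionicHilbertSpace (H : Type*) [NormedAddCommGroup H] [Module ℍᵐᵒᵖ H] where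
  /-- the quaternion-valued scalar product -/
  ip : H → H → ℍ
  ip_self_nonneg : ∀ x, ∃ r : ℝ, 0 ≤ r ∧ ip x x = (r : ℍ)
  ip_self_eq_zero : ∀ x, ip x x = 0 ↔ x = 0
  ip_smul_add : ∀ (x y z : H) (a : ℍ), ip x (op a • y + z) = ip x y * a + ip x z
  ip_star : ∀ x y, ip x y = star (ip y x)
  norm_eq : ∀ x, ‖x‖ = √(ip x x).re
  complete : CompleteSpace H

/-- Quaternionic reproducing kernel Hilbert spaces of left slice hyperholomorphic functions on the
unit ball: the elements of `H` are functions on the unit ball, with pointwise operations, and all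
point evaluations are bounded. -/
class SliceRKHS (H : Type*) [NormedAddCommGroup H] [Module ℍᵐᵒᵖ H]
    [QuaternionicHilbertSpace H] where
  /-- an element of `H` as a function on the unit ball -/
  eval : H →ₗ[ℍᵐᵒᵖ] (unitBall → ℍ)
  eval_injective : Function.Injective eval
  slice : ∀ f : H, IsLeftSliceHyperholomorphic (eval f)
  bounded : ∀ w : unitBall, ∃ C : ℝ, ∀ f : H, ‖eval f w‖ ≤ C * ‖f‖

section

variable {H : Type*} [NormedAddCommGroup H] [Module ℍᵐᵒᵖ H] [QuaternionicHilbertSpace H]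

open QuaternionicHilbertSpace SliceRKHS

theorem ip_add (x y z : H) : ip x (y + z) = ip x y + ip x z := by
  have h := ip_smul_add x y z 1
  simpa using h

theorem ip_zero (x : H) : ip x (0 : H) = 0 := by
  have h := ip_add x 0 0
  simpa using h

theorem ip_smul (x y : H) (a : ℍ) : ip x (op a • y) = ip x y * a := by
  have h := ip_smul_add x y 0 a
  simpa [ip_zero] using h

theorem ip_add_left (x y z : H) : ip (x + y) z = ip x z + ip y z := by
  rw [ip_star, ip_add, star_add, ← ip_star, ← ip_star]

theorem ip_smul_left (x y : H) (a : ℍ) : ip (op a • x) y = star a * ip x y := by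
  rw [ip_star, ip_smul, star_mul, ← ip_star]

theorem norm_sq_eq (x : H) : ‖x‖ ^ 2 = (ip x x).re := by
  obtain ⟨r, hr, h⟩ := ip_self_nonneg x
  rw [norm_eq, Real.sq_sqrt]
  rw [h]
  simpa using hr

theorem norm_op_smul (x : H) (a : ℍ) : ‖op a • x‖ = ‖x‖ * ‖a‖ := by
  obtain ⟨r, -, h⟩ := ip_self_nonneg x
  have h1 : ‖op a • x‖ ^ 2 = (‖x‖ * ‖a‖) ^ 2 := by
    rw [norm_sq_eq, mul_pow, norm_sq_eq, ip_smul, ip_smul_left, h, ← Quaternion.coe_commutes,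
      mul_assoc, Quaternion.star_mul_self, Quaternion.normSq_eq_norm_mul_self]
    simp [sq]
  exact (pow_left_inj₀ (norm_nonneg _) (by positivity) two_ne_zero).mp h1

/-- The Riesz representation theorem for point evaluations. -/
theorem exists_kernel [SliceRKHS H] (w : unitBall) :
    ∃ K : H, ∀ f : H, eval f w = ip K f := by
  let _ : Module ℝ H := Module.compHom H (algebraMap ℝ ℍᵐᵒᵖ)
  have hsm : ∀ (r : ℝ) (x : H), r • x = op (r : ℍ) • x := fun r x => rfl
  let _ : InnerProductSpace ℝ H :=
    { norm_smul_le := fun r x => by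
        rw [hsm, norm_op_smul, Quaternion.norm_coe, mul_comm]
      inner := fun x y => (ip x y).re
      norm_sq_eq_re_inner := fun x => by
        rw [norm_sq_eq]; rfl
      conj_inner_symm := fun x y => by
        change (ip y x).re = (ip x y).re
        rw [ip_star x y]; simp
      add_left := fun x y z => by
        change (ip (x + y) z).re = (ip x z).re + (ip y z).re
        rw [ip_add_left]; simp
      smul_left := fun x y r => by
        change (ip (r • x) y).re = r * (ip x y).re
        rw [hsm, ip_smul_left]; simp }
  have : CompleteSpace H := complete
  obtain ⟨C, hC⟩ := bounded (H := H) w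
  let φ : H →ₗ[ℝ] ℝ :=
    { toFun := fun f => (eval f w).re
      map_add' := fun f g => by simp
      map_smul' := fun r f => by
        rw [hsm, map_smul]; simp [mul_comm] }
  let Φ : StrongDual ℝ H := φ.mkContinuous C fun f =>
    (abs_le_of_sq_le_sq (by
      rw [sq ‖_‖, ← Quaternion.normSq_eq_norm_mul_self, Quaternion.normSq_def']
      nlinarith [sq_nonneg (eval f w).imI, sq_nonneg (eval f w).imJ, sq_nonneg (eval f w).imK])
      (norm_nonneg _) : |(eval f w).re| ≤ ‖eval f w‖).trans (hC f)
  refine ⟨(InnerProductSpace.toDual ℝ H).symm Φ, fun f => ?_⟩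
  set K : H := (InnerProductSpace.toDual ℝ H).symm Φ
  have key : ∀ g : H, (eval g w).re = (ip K g).re := fun g =>
    (InnerProductSpace.toDual_symm_apply (x := g) (y := Φ)).symm
  have key2 : ∀ a : ℍ, (eval f w * a).re = (ip K f * a).re := fun a => by
    rw [← ip_smul, ← key, map_smul]; rfl
  simp only [Quaternion.re_mul] at key2
  have h1 := key2 ⟨1, 0, 0, 0⟩
  have hi := key2 ⟨0, 1, 0, 0⟩
  have hj := key2 ⟨0, 0, 1, 0⟩
  have hk := key2 ⟨0, 0, 0, 1⟩
  ext <;> linarith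

/-- The reproducing kernel function `K_w`, the element of `H` with `f(w) = ⟨K_w, f⟩` for all
`f`. -/
noncomputable def kernelFun (H : Type*) [NormedAddCommGroup H] [Module ℍᵐᵒᵖ H]
    [QuaternionicHilbertSpace H] [SliceRKHS H] (w : unitBall) : H :=
  (exists_kernel (H := H) w).choose

/-- The reproducing kernel `K(q, w) = K_w(q)`. -/
noncomputable def kernel (H : Type*) [NormedAddCommGroup H] [Module ℍᵐᵒᵖ H]
    [QuaternionicHilbertSpace H] [SliceRKHS H] (q w : unitBall) : ℍ :=
  eval (kernelFun H w) q

/-- The normalized reproducing kernel `k_q = K_q / √K(q, q)`. -/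
noncomputable def normalizedKernel (H : Type*) [NormedAddCommGroup H] [Module ℍᵐᵒᵖ H]
    [QuaternionicHilbertSpace H] [SliceRKHS H] (q : unitBall) : H :=
  op (((√(kernel H q q).re)⁻¹ : ℝ) : ℍ) • kernelFun H q

/-- `S` is the adjoint of the bounded right linear operator `T`. -/
def IsAdjoint (T S : H →L[ℍᵐᵒᵖ] H) : Prop := ∀ x y : H, ip (S x) y = ip x (T y)

/-- `T* = -T`. -/
def IsAntiSelfAdjoint (T : H →L[ℍᵐᵒᵖ] H) : Prop := IsAdjoint T (-T)

/-- `T* = T⁻¹`. -/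
def IsUnitary (T : H →L[ℍᵐᵒᵖ] H) : Prop :=
  ∃ S : H →L[ℍᵐᵒᵖ] H, IsAdjoint T S ∧ T.comp S = ContinuousLinearMap.id ℍᵐᵒᵖ H ∧
    S.comp T = ContinuousLinearMap.id ℍᵐᵒᵖ H

/-- The complex subspace `H₊ = {x : J x = x i}`. -/
def plusSpace (J : H →L[ℍᵐᵒᵖ] H) (i : ℍ) : Set H := {x | J x = op i • x}

/-- The set `𝓑_J(H)` of bounded right linear operators commuting with `J`. -/
def commutingOperators (J : H →L[ℍᵐᵒᵖ] H) : Set (H →L[ℍᵐᵒᵖ] H) := {T | T.comp J = J.comp T}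

/-- The right linear span over `ℂ_i` of a set of vectors. -/
def sliceSpan (i : ℍ) (s : Set H) : Set H :=
  AddSubgroup.closure {y | ∃ x ∈ s, ∃ a ∈ slicePlane i, y = op a • x}

/-- The unit disc `𝔻_i = 𝔻 ∩ ℂ_i`, as a subset of the unit ball. -/
def sliceDisc (i : ℍ) : Set unitBall := {q | (q : ℍ) ∈ slicePlane i}

/-- The Berezin transform of `T`: the function `q ↦ ⟨k_q, T k_q⟩` on `𝔻_i`. -/
noncomputable def berezin [SliceRKHS H] (i : ℍ) (T : H →L[ℍᵐᵒᵖ] H) : sliceDisc i → ℍ :=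
  fun q => ip (normalizedKernel H q) (T (normalizedKernel H q))

end

end QuaternionicBerezin

open QuaternionicBerezin

/-! With `A = T - S`, which commutes with `J`, the claim is that `⟨K_q, A K_q⟩ = 0` on `𝔻_i` forces
`A = 0`. The `ℂ_i`-part of `⟨K_z, A K_{conj w}⟩` is holomorphic in `z`, because slices of elements
of `H` are holomorphic, and in `w`, by passing to the adjoint of `A`. It vanishes for `w = conj z`,
a maximal totally real set, hence identically (`eq_zero_of_antidiagonal`,
`sliceProj_ip_sliceKernel_eq_zero`).

Taking the `ℂ_i`-part loses nothing: `K_q` and `A K_q` lie in `H₊ = {x : J x = x i}`, and scalar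
products of vectors of `H₊` lie in `ℂ_i` (`commute_ip_of_mem_plusSpace`). So `A K_q` is orthogonal
to every `K_w`, `w ∈ 𝔻_i`; these span `H₊` densely, hence `A K_q = 0` and `A` vanishes on `H₊`.
Since `H = H₊ + H₊ j` for `j` anticommuting with `i`, right linearity gives `A = 0`
(`eq_zero_of_eqOn_plusSpace`). -/

namespace QuaternionicBerezin

/-! ### Holomorphic functions of two variables vanishing on the antidiagonal. -/

section SeveralComplexVariables

open Filter Topology Metric Complex ComplexConjugate

/-- The derivative in the first variable of a bounded separately holomorphic function is jointly
continuous. -/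
theorem continuousAt_deriv_left_of_bounded {f : ℂ → ℂ → ℂ} {R M : ℝ}
    (h₁ : ∀ w ∈ ball (0 : ℂ) R, DifferentiableOn ℂ (fun z => f z w) (ball 0 R))
    (h₂ : ∀ z ∈ ball (0 : ℂ) R, DifferentiableOn ℂ (fun w => f z w) (ball 0 R))
    (hM : ∀ z ∈ ball (0 : ℂ) R, ∀ w ∈ ball (0 : ℂ) R, ‖f z w‖ ≤ M)
    {p : ℂ × ℂ} (hp₁ : p.1 ∈ ball (0 : ℂ) R) (hp₂ : p.2 ∈ ball (0 : ℂ) R) :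
    ContinuousAt (fun v : ℂ × ℂ => deriv (fun z => f z v.2) v.1) p := by
  obtain ⟨z₀, w₀⟩ := p
  simp only at hp₁ hp₂
  obtain ⟨ε₁, hε₁, hz⟩ := Metric.isOpen_iff.1 isOpen_ball z₀ hp₁
  obtain ⟨ε₂, hε₂, hw⟩ := Metric.isOpen_iff.1 isOpen_ball w₀ hp₂
  set r := ε₁ / 3 with hr
  have hr0 : 0 < r := by positivity
  have hsub : ∀ z ∈ ball z₀ r, closedBall z r ⊆ ball (0 : ℂ) R := fun z hz' y hy => by
    apply hz
    simp only [mem_ball, mem_closedBall] at hz' hy ⊢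
    linarith [dist_triangle y z z₀]
  -- Schwarz lemma: `f z` maps the disc of radius `ε₂` into the closed disc of radius `2 * M` about
  -- `f z w₀`.
  have hlip : ∀ z ∈ ball (0 : ℂ) R, ∀ w ∈ ball w₀ ε₂,
      ‖f z w - f z w₀‖ ≤ 2 * M / ε₂ * dist w w₀ := fun z hz' w hw' => by
    rw [← dist_eq_norm]
    refine Complex.dist_le_div_mul_dist_of_mapsTo_ball (f := fun w => f z w)
      ((h₂ z hz').mono hw) (fun y hy => ?_) hw'
    rw [mem_closedBall, dist_eq_norm]
    linarith [norm_sub_le (f z y) (f z w₀), hM z hz' y (hw hy), hM z hz' w₀ hp₂]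
  -- Cauchy's estimate on the circle of radius `r` turns the Lipschitz bound into one for the
  -- derivatives in `z`.
  have hdiff : ∀ z ∈ ball z₀ r, ∀ w ∈ ball w₀ ε₂,
      ‖deriv (fun z => f z w) z - deriv (fun z => f z w₀) z‖ ≤ 2 * M / ε₂ * dist w w₀ / r :=
    fun z hz' w hw' => by
      have hzR : z ∈ ball (0 : ℂ) R := hsub z hz' (mem_closedBall_self hr0.le)
      have hd := ((h₁ w (hw hw')).differentiableAt (isOpen_ball.mem_nhds hzR))
      have hd₀ := ((h₁ w₀ hp₂).differentiableAt (isOpen_ball.mem_nhds hzR))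
      rw [← deriv_fun_sub hd hd₀]
      refine Complex.norm_deriv_le_of_forall_mem_sphere_norm_le hr0 ?_ fun y hy =>
        hlip y (hsub z hz' (sphere_subset_closedBall hy)) w hw'
      refine DifferentiableOn.diffContOnCl_ball (U := ball (0 : ℂ) R) ?_ (hsub z hz')
      exact (h₁ w (hw hw')).sub (h₁ w₀ hp₂)
  have hlim₀ : Tendsto (fun v : ℂ × ℂ => deriv (fun z => f z w₀) v.1) (𝓝 (z₀, w₀))
      (𝓝 (deriv (fun z => f z w₀) z₀)) := by
    have : ContinuousAt (deriv (fun z => f z w₀)) z₀ :=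
      ((h₁ w₀ hp₂).deriv isOpen_ball).continuousOn.continuousAt (isOpen_ball.mem_nhds hp₁)
    exact this.tendsto.comp (continuous_fst.tendsto (z₀, w₀))
  have hlim₁ : Tendsto (fun v : ℂ × ℂ => deriv (fun z => f z v.2) v.1 -
      deriv (fun z => f z w₀) v.1) (𝓝 (z₀, w₀)) (𝓝 0) := by
    refine squeeze_zero_norm' (a := fun v : ℂ × ℂ => 2 * M / ε₂ * dist v.2 w₀ / r) ?_ ?_
    · filter_upwards [prod_mem_nhds (ball_mem_nhds z₀ hr0) (ball_mem_nhds w₀ hε₂)] with v hv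
      exact hdiff v.1 hv.1 v.2 hv.2
    · have : Continuous fun v : ℂ × ℂ => 2 * M / ε₂ * dist v.2 w₀ / r := by fun_prop
      simpa using this.tendsto (z₀, w₀)
  have := hlim₁.add hlim₀
  simpa [ContinuousAt] using this

/-- Osgood's lemma: a bounded separately holomorphic function is holomorphic. -/
theorem differentiableAt_of_separately_of_bounded {f : ℂ → ℂ → ℂ} {R M : ℝ}
    (h₁ : ∀ w ∈ ball (0 : ℂ) R, DifferentiableOn ℂ (fun z => f z w) (ball 0 R))
    (h₂ : ∀ z ∈ ball (0 : ℂ) R, DifferentiableOn ℂ (fun w => f z w) (ball 0 R))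
    (hM : ∀ z ∈ ball (0 : ℂ) R, ∀ w ∈ ball (0 : ℂ) R, ‖f z w‖ ≤ M)
    {p : ℂ × ℂ} (hp₁ : p.1 ∈ ball (0 : ℂ) R) (hp₂ : p.2 ∈ ball (0 : ℂ) R) :
    DifferentiableAt ℂ (fun v : ℂ × ℂ => f v.1 v.2) p := by
  have hev : ∀ᶠ v : ℂ × ℂ in 𝓝 p, v.1 ∈ ball (0 : ℂ) R ∧ v.2 ∈ ball (0 : ℂ) R :=
    ((continuous_fst.tendsto p).eventually (isOpen_ball.mem_nhds hp₁)).and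
      ((continuous_snd.tendsto p).eventually (isOpen_ball.mem_nhds hp₂))
  have c₁ := continuousAt_deriv_left_of_bounded h₁ h₂ hM hp₁ hp₂
  have c₂ : ContinuousAt (fun v : ℂ × ℂ => deriv (fun w => f v.1 w) v.2) p :=
    (continuousAt_deriv_left_of_bounded (f := fun w z => f z w) h₂ h₁
      (fun w hw z hz => hM z hz w hw) (p := p.swap) hp₂ hp₁).comp continuous_swap.continuousAt
  exact (hasStrictFDerivAt_uncurry_coprod (𝕜 := ℂ) (f := f)
    (f₁ := fun z w => ContinuousLinearMap.toSpanSingleton ℂ (deriv (fun z => f z w) z))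
    (f₂ := fun z w => ContinuousLinearMap.toSpanSingleton ℂ (deriv (fun w => f z w) w))
    (u := p)
    (hev.mono fun v hv => ((h₁ v.2 hv.2).differentiableAt
      (isOpen_ball.mem_nhds hv.1)).hasDerivAt.hasFDerivAt)
    (hev.mono fun v hv => ((h₂ v.1 hv.1).differentiableAt
      (isOpen_ball.mem_nhds hv.2)).hasDerivAt.hasFDerivAt)
    ((ContinuousLinearMap.toSpanSingletonCLE (𝕜 := ℂ) (E := ℂ)).continuous.continuousAt.comp c₁)
    ((ContinuousLinearMap.toSpanSingletonCLE (𝕜 := ℂ) (E := ℂ)).continuous.continuousAt.comp c₂)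
    ).differentiableAt

/-- A holomorphic function on a disc that vanishes on the real diameter is zero. -/
theorem eq_zero_of_real_eq_zero {h : ℂ → ℂ} {r : ℝ} (hr : 0 < r)
    (hd : DifferentiableOn ℂ h (ball 0 r)) (h0 : ∀ t : ℝ, (t : ℂ) ∈ ball (0 : ℂ) r → h t = 0) :
    ∀ z ∈ ball (0 : ℂ) r, h z = 0 := by
  refine (hd.analyticOnNhd isOpen_ball).eqOn_zero_of_preconnected_of_frequently_eq_zero
    (convex_ball _ _).isPreconnected (mem_ball_self hr) ?_
  have ht : Tendsto (fun t : ℝ => (t : ℂ)) (𝓝[≠] 0) (𝓝[≠] 0) := by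
    refine tendsto_nhdsWithin_iff.2 ⟨?_, ?_⟩
    · have := Complex.continuous_ofReal.tendsto 0
      simp only [ofReal_zero] at this
      exact this.mono_left nhdsWithin_le_nhds
    · filter_upwards [self_mem_nhdsWithin] with t ht
      simpa using ht
  refine ht.frequently (Eventually.frequently ?_)
  filter_upwards [ht.eventually (nhdsWithin_le_nhds (ball_mem_nhds (0 : ℂ) hr))] with t ht
  exact h0 t ht

/-- A holomorphic function of two variables that vanishes on the antidiagonal `w = conj z` vanishes
near the origin. -/
theorem eq_zero_near_of_antidiagonal {f : ℂ → ℂ → ℂ} {R : ℝ} (hR : 0 < R)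
    (hd : ∀ z ∈ ball (0 : ℂ) R, ∀ w ∈ ball (0 : ℂ) R,
      DifferentiableAt ℂ (fun v : ℂ × ℂ => f v.1 v.2) (z, w))
    (h0 : ∀ z ∈ ball (0 : ℂ) R, f z (conj z) = 0) :
    ∀ z ∈ ball (0 : ℂ) (R / 2), ∀ w ∈ ball (0 : ℂ) (R / 2), f z w = 0 := by
  have hadd : ∀ u ∈ ball (0 : ℂ) (R / 2), ∀ v ∈ ball (0 : ℂ) (R / 2),
      u + I * v ∈ ball (0 : ℂ) R ∧ u - I * v ∈ ball (0 : ℂ) R := fun u hu v hv => by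
    simp only [mem_ball_zero_iff] at *
    have hI : ‖I * v‖ = ‖v‖ := by simp
    constructor
    · linarith [norm_add_le u (I * v)]
    · linarith [norm_sub_le u (I * v)]
  have hr : 0 < R / 2 := by positivity
  -- In the coordinates `z = u + I v`, `w = u - I v` the antidiagonal is the set of real `u, v`. The
  -- one-variable identity theorem frees `u` first, then `v`.
  have real_v : ∀ v : ℝ, (v : ℂ) ∈ ball (0 : ℂ) (R / 2) → ∀ u ∈ ball (0 : ℂ) (R / 2),
      f (u + I * v) (u - I * v) = 0 := fun v hv => by
    refine eq_zero_of_real_eq_zero hr (fun u hu => ?_) fun u hu => ?_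
    · have := hd _ (hadd u hu v hv).1 _ (hadd u hu v hv).2
      exact (this.comp (f := fun u : ℂ => (u + I * v, u - I * v)) u
        (by fun_prop)).differentiableWithinAt
    · have := h0 _ (hadd u hu v hv).1
      simpa [sub_eq_add_neg] using this
  have all_v : ∀ u ∈ ball (0 : ℂ) (R / 2), ∀ v ∈ ball (0 : ℂ) (R / 2),
      f (u + I * v) (u - I * v) = 0 := fun u hu => by
    refine eq_zero_of_real_eq_zero (h := fun v => f (u + I * v) (u - I * v)) hr (fun v hv => ?_)
      fun v hv => real_v v hv u hu
    have := hd _ (hadd u hu v hv).1 _ (hadd u hu v hv).2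
    exact (this.comp (f := fun v : ℂ => (u + I * v, u - I * v)) v
        (by fun_prop)).differentiableWithinAt
  intro z hz w hw
  have key := all_v ((z + w) / 2) ?_ (-I * ((z - w) / 2)) ?_
  · have e : I * (-I * ((z - w) / 2)) = (z - w) / 2 := by
      linear_combination (-(z - w) / 2) * I_mul_I
    rw [e] at key
    convert key using 2 <;> ring
  · simp only [mem_ball_zero_iff] at *
    rw [norm_div, Complex.norm_two]
    linarith [norm_add_le z w]
  · simp only [mem_ball_zero_iff] at *
    rw [norm_mul, norm_neg, norm_I, one_mul, norm_div, Complex.norm_two]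
    linarith [norm_sub_le z w]

/-- A separately holomorphic function on a bidisc, bounded near the origin, that vanishes on the
antidiagonal `w = conj z` is zero. -/
theorem eq_zero_of_antidiagonal {f : ℂ → ℂ → ℂ} {r R M : ℝ} (hR : 0 < R) (hRr : R ≤ r)
    (h₁ : ∀ w ∈ ball (0 : ℂ) r, DifferentiableOn ℂ (fun z => f z w) (ball 0 r))
    (h₂ : ∀ z ∈ ball (0 : ℂ) r, DifferentiableOn ℂ (fun w => f z w) (ball 0 r))
    (hM : ∀ z ∈ ball (0 : ℂ) R, ∀ w ∈ ball (0 : ℂ) R, ‖f z w‖ ≤ M)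
    (h0 : ∀ z ∈ ball (0 : ℂ) R, f z (conj z) = 0) :
    ∀ z ∈ ball (0 : ℂ) r, ∀ w ∈ ball (0 : ℂ) r, f z w = 0 := by
  have hsub : ball (0 : ℂ) R ⊆ ball 0 r := ball_subset_ball hRr
  have hsub2 : ball (0 : ℂ) (R / 2) ⊆ ball 0 r := ball_subset_ball (by linarith)
  have near := eq_zero_near_of_antidiagonal hR (fun z hz w hw =>
    differentiableAt_of_separately_of_bounded (fun w hw => (h₁ w (hsub hw)).mono hsub)
      (fun z hz => (h₂ z (hsub hz)).mono hsub) hM (p := (z, w)) hz hw) h0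
  have ext : ∀ g : ℂ → ℂ, DifferentiableOn ℂ g (ball 0 r) →
      (∀ z ∈ ball (0 : ℂ) (R / 2), g z = 0) → ∀ z ∈ ball (0 : ℂ) r, g z = 0 := fun g hg hg0 =>
    (hg.analyticOnNhd isOpen_ball).eqOn_zero_of_preconnected_of_eventuallyEq_zero
      (convex_ball _ _).isPreconnected (mem_ball_self (hR.trans_le hRr))
      (eventually_of_mem (ball_mem_nhds _ (half_pos hR)) hg0)
  -- The inner extension is in `z` for small `w`, the outer one in `w` for arbitrary `z`; only
  -- separate holomorphy is needed away from the origin.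
  exact fun z hz => ext _ (h₂ z hz) fun w hw =>
    ext _ (h₁ w (hsub2 hw)) (fun z hz => near z hz w hw) z hz

end SeveralComplexVariables

/-! ### The slice `ℂ_i` as a copy of `ℂ`, and holomorphy of slices. -/

section SliceEmbedding

/-- The embedding of `ℂ` into the quaternions with image `ℂ_i`. -/
noncomputable def sliceEmb (i : ℍ) (z : ℂ) : ℍ := (z.re : ℍ) + i * (z.im : ℍ)

/-- The real linear projection of the quaternions onto `ℂ_i`, with values in `ℂ`. -/
noncomputable def sliceProj (i : ℍ) : ℍ →L[ℝ] ℂ :=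
  LinearMap.toContinuousLinearMap
    -- For an imaginary unit `i`, `-(i * q).re` is the Euclidean inner product of `i` and `q`, that
    -- is, the `i`-coordinate of `q`.
    { toFun := fun q => ⟨q.re, -(i * q).re⟩
      map_add' := fun x y => by apply Complex.ext <;> simp [mul_add]; ring
      map_smul' := fun r x => by apply Complex.ext <;> simp; ring }

@[simp]
theorem sliceProj_re (i q : ℍ) : (sliceProj i q).re = q.re := rfl

@[simp]
theorem sliceProj_im (i q : ℍ) : (sliceProj i q).im = -(i * q).re := rfl

theorem mul_self_of_mem_imagUnits {i : ℍ} (hi : i ∈ imagUnits) : i * i = -1 := by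
  obtain ⟨h0, h1⟩ := hi
  have hs : star i = -i := by
    rw [Quaternion.star_eq_neg]; exact h0
  have := Quaternion.star_mul_self i
  rw [hs, Quaternion.normSq_eq_norm_mul_self, h1] at this
  rw [← neg_neg (i * i), ← neg_mul, this]; simp

theorem star_of_mem_imagUnits {i : ℍ} (hi : i ∈ imagUnits) : star i = -i := by
  rw [Quaternion.star_eq_neg]; exact hi.1

/-- Linearity for multiplication on the left is what matters, since slice functions have the form `α
+ i β`. -/
theorem sliceProj_mul {i : ℍ} (hi : i ∈ imagUnits) (q : ℍ) :
    sliceProj i (i * q) = Complex.I * sliceProj i q := by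
  apply Complex.ext
  · simp
  · simp [← mul_assoc, mul_self_of_mem_imagUnits hi]

theorem sliceProj_star {i : ℍ} (hi : i ∈ imagUnits) (q : ℍ) :
    sliceProj i (star q) = (starRingEnd ℂ) (sliceProj i q) := by
  apply Complex.ext
  · simp
  · have h0 := hi.1
    simp [Quaternion.re_mul, h0]
    ring

theorem norm_sliceEmb {i : ℍ} (hi : i ∈ imagUnits) (z : ℂ) : ‖sliceEmb i z‖ = ‖z‖ := by
  have h1 : i.imI ^ 2 + i.imJ ^ 2 + i.imK ^ 2 = 1 := by
    have := Quaternion.normSq_eq_norm_mul_self i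
    rw [hi.2, Quaternion.normSq_def', hi.1] at this
    linarith
  have h0 := hi.1
  have : ‖sliceEmb i z‖ ^ 2 = ‖z‖ ^ 2 := by
    rw [sq, ← Quaternion.normSq_eq_norm_mul_self, Quaternion.normSq_def', Complex.sq_norm,
      Complex.normSq_apply]
    simp [sliceEmb, h0]
    linear_combination z.im ^ 2 * h1
  exact (pow_left_inj₀ (norm_nonneg _) (norm_nonneg _) two_ne_zero).1 this

theorem sliceEmb_mem_unitBall {i : ℍ} (hi : i ∈ imagUnits) {z : ℂ} :
    sliceEmb i z ∈ unitBall ↔ z ∈ Metric.ball (0 : ℂ) 1 := by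
  simp [unitBall, norm_sliceEmb hi]

/-- Quaternions commuting with `i` that have zero projection on `ℂ_i` vanish. -/
theorem eq_zero_of_sliceProj_eq_zero {i : ℍ} (hi : i ∈ imagUnits) {q : ℍ} (hq : i * q = q * i)
    (h : sliceProj i q = 0) : q = 0 := by
  have h1 : i.imI ^ 2 + i.imJ ^ 2 + i.imK ^ 2 = 1 := by
    have := Quaternion.normSq_eq_norm_mul_self i
    rw [hi.2, Quaternion.normSq_def', hi.1] at this
    linarith
  have h0 := hi.1
  have hre : q.re = 0 := congrArg Complex.re h
  have him : (i * q).re = 0 := neg_eq_zero.1 (congrArg Complex.im h)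
  -- Commuting with `i` gives `i × q = 0` and zero projection gives `i · q = 0`; then `q |i|² = i (i
  -- · q) - i × (i × q)` gives `q = 0`.
  have eI := congrArg QuaternionAlgebra.imI hq
  have eJ := congrArg QuaternionAlgebra.imJ hq
  have eK := congrArg QuaternionAlgebra.imK hq
  simp [h0, hre] at him eI eJ eK
  ext
  · exact hre
  · simp only [Quaternion.imI_zero]
    linear_combination (-q.imI) * h1 - i.imI * him - i.imJ * eK / 2 + i.imK * eJ / 2
  · simp only [Quaternion.imJ_zero]
    linear_combination (-q.imJ) * h1 - i.imJ * him - i.imK * eI / 2 + i.imI * eK / 2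
  · simp only [Quaternion.imK_zero]
    linear_combination (-q.imK) * h1 - i.imK * him - i.imI * eJ / 2 + i.imJ * eI / 2

/-- Every imaginary unit anticommutes with some nonzero quaternion. -/
theorem exists_anticommuting {i : ℍ} (hi : i ∈ imagUnits) : ∃ j : ℍ, j ≠ 0 ∧ i * j = -(j * i) := by
  have h0 := hi.1
  have aux : ∀ a b : ℝ, ∃ j : ℍ, j.re = 0 ∧ j.imI = a ∧ j.imJ = b ∧ j.imK = 0 := fun a b =>
    ⟨⟨0, a, b, 0⟩, rfl, rfl, rfl, rfl⟩
  -- Orthogonal imaginary quaternions anticommute, so any nonzero imaginary vector orthogonal to `i`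
  -- serves as `j`.
  by_cases hJ : i.imI = 0 ∧ i.imJ = 0
  · obtain ⟨j, j0, j1, j2, j3⟩ := aux 1 0
    refine ⟨j, fun h => ?_, ?_⟩
    · simp [h] at j1
    · ext <;> simp [h0, hJ.1, hJ.2, j0, j1, j2, j3]
  · obtain ⟨j, j0, j1, j2, j3⟩ := aux (-i.imJ) i.imI
    refine ⟨j, fun h => hJ ?_, ?_⟩
    · simp [h] at j1 j2
      exact ⟨j2.symm, j1⟩
    · ext <;> simp [h0, j0, j1, j2, j3] <;> ring

/-- The slices of a left slice hyperholomorphic function are holomorphic. -/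
theorem IsLeftSliceHyperholomorphic.differentiableOn_slice {f : unitBall → ℍ}
    (hf : IsLeftSliceHyperholomorphic f) {i : ℍ} (hi : i ∈ imagUnits) {g : ℂ → ℂ}
    (hg : ∀ z, ∀ h : sliceEmb i z ∈ unitBall, g z = sliceProj i (f ⟨sliceEmb i z, h⟩)) :
    DifferentiableOn ℂ g (Metric.ball 0 1) := by
  obtain ⟨-, α, β, hαβ, hCR⟩ := hf
  intro z hz
  apply DifferentiableAt.differentiableWithinAt
  obtain ⟨-, -, hα, hβ, c₁, c₂⟩ := hCR i hi z.re z.im ((sliceEmb_mem_unitBall hi).2 hz)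
  have heq : g =ᶠ[nhds z] fun w =>
      sliceProj i (α (Complex.equivRealProdCLM w)) +
        Complex.I * sliceProj i (β (Complex.equivRealProdCLM w)) := by
    filter_upwards [Metric.isOpen_ball.mem_nhds hz] with w hw
    rw [hg w ((sliceEmb_mem_unitBall hi).2 hw), ← sliceProj_mul hi, ← map_add]
    exact congrArg _ (hαβ i hi w.re w.im ((sliceEmb_mem_unitBall hi).2 hw))
  rw [heq.differentiableAt_iff]
  have hA := ((sliceProj i).hasFDerivAt.comp z
    (hα.hasFDerivAt.comp z Complex.equivRealProdCLM.hasFDerivAt))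
  have hB := ((sliceProj i).hasFDerivAt.comp z
    (hβ.hasFDerivAt.comp z Complex.equivRealProdCLM.hasFDerivAt))
  have hT := hA.add (hB.const_mul Complex.I)
  have part_a : ∀ γ : ℝ × ℝ → ℍ, DifferentiableAt ℝ γ (z.re, z.im) →
      deriv (fun s => γ (s, z.im)) z.re = fderiv ℝ γ (z.re, z.im) (1, 0) := fun γ hγ =>
    (hγ.hasFDerivAt.comp_hasDerivAt z.re
      ((hasDerivAt_id z.re).prodMk (hasDerivAt_const z.re z.im))).deriv
  have part_b : ∀ γ : ℝ × ℝ → ℍ, DifferentiableAt ℝ γ (z.re, z.im) →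
      deriv (fun t => γ (z.re, t)) z.im = fderiv ℝ γ (z.re, z.im) (0, 1) := fun γ hγ =>
    (hγ.hasFDerivAt.comp_hasDerivAt z.im
      ((hasDerivAt_const z.im z.re).prodMk (hasDerivAt_id z.im))).deriv
  rw [part_a α hα, part_b β hβ] at c₁
  rw [part_a β hβ, part_b α hα] at c₂
  -- What remains is that the real derivative at `I` is `I` times the one at `1`, which is the
  -- Cauchy-Riemann system for `α, β`.
  refine differentiableAt_complex_iff_differentiableAt_real.2 ⟨hT.differentiableAt, ?_⟩
  have e1 : Complex.equivRealProdCLM 1 = ((1 : ℝ), (0 : ℝ)) := rfl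
  have eI : Complex.equivRealProdCLM Complex.I = ((0 : ℝ), (1 : ℝ)) := rfl
  erw [hT.fderiv]
  simp [e1, eI, c₁, ← neg_eq_iff_eq_neg.2 c₂]
  linear_combination -(sliceProj i) ((fderiv ℝ β (z.re, z.im)) (1, 0)) * Complex.I_mul_I

end SliceEmbedding

/-! ### Quaternionic Hilbert space tools obtained from the underlying real Hilbert space. -/

section HilbertSpace

variable {H : Type*} [NormedAddCommGroup H] [Module ℍᵐᵒᵖ H] [QuaternionicHilbertSpace H]

open QuaternionicHilbertSpace SliceRKHS

/-- The real vector space underlying a right quaternionic module. -/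
noncomputable abbrev realModule (H : Type*) [AddCommGroup H] [Module ℍᵐᵒᵖ H] : Module ℝ H :=
  Module.compHom H (algebraMap ℝ ℍᵐᵒᵖ)

/-- The real Hilbert space underlying a quaternionic Hilbert space, with the real part of the
scalar product. -/
noncomputable abbrev realInnerProductSpace (H : Type*) [NormedAddCommGroup H] [Module ℍᵐᵒᵖ H]
    [QuaternionicHilbertSpace H] : InnerProductSpace ℝ H :=
  have hsm : ∀ (r : ℝ) (x : H), (realModule H).smul r x = op (r : ℍ) • x := fun _ _ => rfl
  { toModule := realModule H
    norm_smul_le := fun r x => by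
      change ‖(realModule H).smul r x‖ ≤ _
      rw [hsm, norm_op_smul, Quaternion.norm_coe, mul_comm]
    inner := fun x y => (ip x y).re
    norm_sq_eq_re_inner := fun x => by
      rw [norm_sq_eq]; rfl
    conj_inner_symm := fun x y => by
      change (ip y x).re = (ip x y).re
      rw [ip_star x y]; simp
    add_left := fun x y z => by
      change (ip (x + y) z).re = (ip x z).re + (ip y z).re
      rw [ip_add_left]; simp
    smul_left := fun x y r => by
      change (ip ((realModule H).smul r x) y).re = r * (ip x y).re
      rw [hsm, ip_smul_left]; simp }

/-- Together with right linearity, this lifts identities for the real inner product to the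
quaternionic one. -/
theorem eq_of_re_mul_eq {p q : ℍ} (h : ∀ a : ℍ, (p * a).re = (q * a).re) : p = q := by
  simp only [Quaternion.re_mul] at h
  have h1 := h ⟨1, 0, 0, 0⟩
  have hi := h ⟨0, 1, 0, 0⟩
  have hj := h ⟨0, 0, 1, 0⟩
  have hk := h ⟨0, 0, 0, 1⟩
  ext <;> linarith

/-- Bounded right linear operators have adjoints: `G` is the value of the adjoint at `k`. -/
theorem exists_adjoint_apply (A : H →L[ℍᵐᵒᵖ] H) (k : H) :
    ∃ G : H, ∀ x : H, ip k (A x) = ip G x := by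
  let _ := realInnerProductSpace H
  have : CompleteSpace H := complete
  let A' : H →L[ℝ] H :=
    { toFun := A
      map_add' := map_add A
      map_smul' := fun r x => A.map_smul (op (r : ℍ)) x
      cont := A.continuous }
  have key : ∀ y : H, (ip k (A y)).re = (ip (A'.adjoint k) y).re := fun y =>
    (ContinuousLinearMap.adjoint_inner_left A' y k).symm
  refine ⟨A'.adjoint k, fun x => eq_of_re_mul_eq fun a => ?_⟩
  rw [← ip_smul, ← A.map_smul, key, ip_smul]

/-- Continuous right linear operators are bounded. -/
theorem exists_bound_apply (A : H →L[ℍᵐᵒᵖ] H) : ∃ C : ℝ, 0 ≤ C ∧ ∀ x : H, ‖A x‖ ≤ C * ‖x‖ := by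
  let _ := realInnerProductSpace H
  let A' : H →L[ℝ] H :=
    { toFun := A
      map_add' := map_add A
      map_smul' := fun r x => A.map_smul (op (r : ℍ)) x
      cont := A.continuous }
  exact ⟨‖A'‖, norm_nonneg _, A'.le_opNorm⟩

theorem continuous_re_ip_left (y : H) : Continuous fun x : H => (ip x y).re := by
  let _ := realInnerProductSpace H
  exact (continuous_id (X := H)).inner (𝕜 := ℝ) (continuous_const (y := y))

/-- The Cauchy-Schwarz inequality. -/
theorem norm_ip_le (x y : H) : ‖ip x y‖ ≤ ‖x‖ * ‖y‖ := by
  let _ := realInnerProductSpace H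
  by_cases h0 : ip x y = 0
  · rw [h0, norm_zero]; positivity
  -- Multiplying `y` by the conjugate of `ip x y` makes the scalar product real, equal to `‖ip x y‖
  -- ^ 2`.
  have h1 : (ip x (op (star (ip x y)) • y)).re ≤ ‖x‖ * ‖op (star (ip x y)) • y‖ :=
    real_inner_le_norm x _
  rw [ip_smul, Quaternion.self_mul_star, Quaternion.re_coe, Quaternion.normSq_eq_norm_mul_self,
    norm_op_smul, norm_star, ← mul_assoc] at h1
  exact le_of_mul_le_mul_right h1 (norm_pos_iff.2 h0)

theorem eval_eq_ip [SliceRKHS H] (f : H) (w : unitBall) : eval f w = ip (kernelFun H w) f :=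
  (exists_kernel (H := H) w).choose_spec f

theorem eval_kernelFun_self_re_pos [SliceRKHS H] {q : unitBall} (h : ∃ f : H, eval f q ≠ 0) :
    0 < (kernel H q q).re := by
  obtain ⟨f, hf⟩ := h
  rw [kernel, eval_eq_ip, ← norm_sq_eq]
  have : kernelFun H q ≠ 0 := fun h0 => hf (by
    rw [eval_eq_ip, ip_star, h0, ip_zero, star_zero])
  positivity

theorem ip_normalizedKernel [SliceRKHS H] (T : H →L[ℍᵐᵒᵖ] H) (q : unitBall) :
    ip (normalizedKernel H q) (T (normalizedKernel H q)) =
      (((√(kernel H q q).re)⁻¹ * (√(kernel H q q).re)⁻¹ : ℝ) : ℍ) *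
        ip (kernelFun H q) (T (kernelFun H q)) := by
  rw [normalizedKernel, T.map_smul, ip_smul, ip_smul_left, Quaternion.star_coe, mul_assoc,
    ← Quaternion.coe_commutes, ← mul_assoc, Quaternion.coe_mul]

theorem ip_kernelFun_eq_of_normalizedKernel [SliceRKHS H] {S T : H →L[ℍᵐᵒᵖ] H} {q : unitBall}
    (hne : ∃ f : H, eval f q ≠ 0)
    (h : ip (normalizedKernel H q) (T (normalizedKernel H q)) =
      ip (normalizedKernel H q) (S (normalizedKernel H q))) :
    ip (kernelFun H q) (T (kernelFun H q)) = ip (kernelFun H q) (S (kernelFun H q)) := by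
  rw [ip_normalizedKernel, ip_normalizedKernel] at h
  -- If `K_q` were zero, the factor would be `0⁻¹ = 0` and the transform would say nothing at `q`;
  -- `hne` excludes this.
  refine mul_left_cancel₀ ?_ h
  have := Real.sqrt_pos.2 (eval_kernelFun_self_re_pos hne)
  exact fun h0 => (by positivity : (√(kernel H q q).re)⁻¹ * (√(kernel H q q).re)⁻¹ ≠ 0)
    (Quaternion.coe_injective h0)

/-- The kernel functions are bounded in norm on compact subsets of the ball. -/
theorem exists_norm_kernelFun_le [SliceRKHS H] {s : Set unitBall} (hs : IsCompact s) :
    ∃ C : ℝ, 0 ≤ C ∧ ∀ w ∈ s, ‖kernelFun H w‖ ≤ C := by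
  let _ := realInnerProductSpace H
  have : CompleteSpace H := complete
  have hcont : ∀ f : H, Continuous (eval f) := fun f => by
    obtain ⟨⟨F, hF, hd⟩, -⟩ := slice f
    have := hd.continuousOn.domRestrict
    convert this using 1
    exact funext fun x => (hF x).symm
  let g : s → H →L[ℝ] ℝ := fun w => innerSL ℝ (kernelFun H w)
  have hg : ∀ w f, g w f = (eval f w).re := fun w f => by
    rw [eval_eq_ip]; rfl
  -- The functional `g w` has norm `‖kernelFun H w‖`, and each `f` is bounded on the compact set `s`
  -- by continuity.
  obtain ⟨C, hC⟩ := banach_steinhaus (g := g) fun f => by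
    obtain ⟨C, hC⟩ := hs.exists_bound_of_continuousOn
      (f := fun w => (eval f w).re) (Quaternion.continuous_re.comp (hcont f)).continuousOn
    exact ⟨C, fun w => by rw [hg]; exact hC w w.2⟩
  refine ⟨max C 0, le_max_right _ _, fun w hw => le_max_of_le_left ?_⟩
  have := hC ⟨w, hw⟩
  rwa [innerSL_apply_norm] at this

end HilbertSpace

/-! ### Operators acting on `H₊` and on closed slice spans. -/

section RightModule

variable {H : Type*} [NormedAddCommGroup H] [Module ℍᵐᵒᵖ H]

theorem map_mem_plusSpace {J A : H →L[ℍᵐᵒᵖ] H} {i : ℍ} (hA : A.comp J = J.comp A) {x : H}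
    (hx : x ∈ plusSpace J i) : A x ∈ plusSpace J i := by
  have h : A (J x) = J (A x) := congrArg (fun B : H →L[ℍᵐᵒᵖ] H => B x) hA
  change J (A x) = op i • A x
  rw [← h, show J x = op i • x from hx, A.map_smul]

theorem map_eq_zero_of_mem_closure_sliceSpan {i : ℍ} {s : Set H} {A : H →L[ℍᵐᵒᵖ] H}
    (h : ∀ x ∈ s, A x = 0) {x : H} (hx : x ∈ closure (sliceSpan i s)) : A x = 0 := by
  refine closure_minimal (t := {x : H | A x = 0}) ?_
    (isClosed_singleton.preimage A.continuous) hx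
  intro x hx
  refine AddSubgroup.closure_induction (p := fun x _ => A x = 0) ?_ (map_zero A) ?_ ?_ hx
  · rintro _ ⟨x, hx, a, -, rfl⟩
    rw [A.map_smul, h x hx, smul_zero]
  · intro a b _ _ ha hb
    rw [map_add, ha, hb, add_zero]
  · intro a _ ha
    rw [map_neg, ha, neg_zero]

theorem subset_closure_sliceSpan (i : ℍ) (s : Set H) : s ⊆ closure (sliceSpan i s) := fun x hx =>
  subset_closure (AddSubgroup.subset_closure ⟨x, hx, 1, ⟨1, 0, by simp⟩, by simp⟩)

end RightModule

/-! ### The splitting of `H` induced by `J`. -/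

section CommutingOperators

variable {H : Type*} [NormedAddCommGroup H] [Module ℍᵐᵒᵖ H] [QuaternionicHilbertSpace H]

open QuaternionicHilbertSpace SliceRKHS

/-- The scalar product of two vectors of `H₊` lies in `ℂ_i`. -/
theorem commute_ip_of_mem_plusSpace {J : H →L[ℍᵐᵒᵖ] H} (hJ : IsAntiSelfAdjoint J) {i : ℍ}
    (hi : i ∈ imagUnits) {x y : H} (hx : x ∈ plusSpace J i) (hy : y ∈ plusSpace J i) :
    i * ip x y = ip x y * i := by
  have h := hJ x y
  have e : (-J) x = op (-i) • x := by
    rw [neg_apply, show J x = op i • x from hx, op_neg, neg_smul]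
  rw [e, show J y = op i • y from hy, ip_smul, ip_smul_left, star_neg, star_of_mem_imagUnits hi,
    neg_neg] at h
  exact h

theorem eq_zero_of_op_smul_eq_zero {a : ℍ} (ha : a ≠ 0) {x : H} (h : op a • x = 0) : x = 0 := by
  have := norm_op_smul x a
  rw [h, norm_zero, zero_eq_mul] at this
  exact norm_eq_zero.1 (this.resolve_right (norm_ne_zero_iff.2 ha))

/-- A bounded operator that vanishes on `H₊` is zero. -/
theorem eq_zero_of_eqOn_plusSpace {J : H →L[ℍᵐᵒᵖ] H} (hJa : IsAntiSelfAdjoint J)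
    (hJu : IsUnitary J) {i : ℍ} (hi : i ∈ imagUnits) {A : H →L[ℍᵐᵒᵖ] H}
    (hA : ∀ x ∈ plusSpace J i, A x = 0) (x : H) : A x = 0 := by
  -- The inverse of `J` and `-J` are both adjoints of `J`, so they coincide.
  have hJJ : J (J x) = -x := by
    obtain ⟨S, hS, -, hSJ⟩ := hJu
    have hS' : S (J x) = x := congrArg (fun B : H →L[ℍᵐᵒᵖ] H => B x) hSJ
    have h0 : S (J x) = (-J) (J x) := by
      refine sub_eq_zero.1 ((ip_self_eq_zero _).1 ?_)
      set d := S (J x) - (-J) (J x) with hd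
      have e : S (J x) = d + (-J) (J x) := by rw [hd]; abel
      have h1 := hS (J x) d
      rw [e, ip_add_left, hJa (J x) d] at h1
      simpa using h1
    rw [hS'] at h0
    rw [neg_apply] at h0
    rw [eq_neg_iff_add_eq_zero, add_comm, ← eq_neg_iff_add_eq_zero]
    exact h0
  have hii := mul_self_of_mem_imagUnits hi
  have hmm : ∀ y : H, op i • op i • y = -y := fun y => by
    rw [smul_smul, ← op_mul, hii, op_neg, op_one, neg_smul, one_smul]
  -- Here `2 x = (x - J x i) + (x + J x i)`. The first summand is in `H₊`; the second satisfies `J y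
  -- = -y i`, and right multiplication by `j` moves it into `H₊`.
  have h₁ : A (x - op i • J x) = 0 := hA _ (by
    change J _ = _
    rw [map_sub, J.map_smul, hJJ, smul_sub, hmm, smul_neg]; abel)
  obtain ⟨j, hj0, hj⟩ := exists_anticommuting hi
  have hJy : J (x + op i • J x) = -(op i • (x + op i • J x)) := by
    rw [map_add, J.map_smul, hJJ, smul_add, hmm, smul_neg]; abel
  have h₂ : A (op j • (x + op i • J x)) = 0 := hA _ (by
    change J _ = _
    rw [J.map_smul, hJy, smul_neg, smul_smul, smul_smul, ← op_mul, ← op_mul, hj, op_neg, neg_smul,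
      neg_neg])
  have h₃ : A (x + op i • J x) = 0 := eq_zero_of_op_smul_eq_zero hj0 (by rw [← A.map_smul, h₂])
  have h₄ : A x + A x = 0 := by
    rw [← add_zero (0 : H)]
    nth_rewrite 2 [← h₁]
    rw [← h₃, ← map_add, ← map_add]
    congr 1
    abel
  refine eq_zero_of_op_smul_eq_zero (a := 2) (fun h => ?_) ?_
  · rw [← one_add_one_eq_two] at h
    have := congrArg QuaternionAlgebra.re h
    simp only [Quaternion.re_add, Quaternion.re_one, Quaternion.re_zero] at this
    norm_num at this
  · rw [← one_add_one_eq_two, op_add, op_one, add_smul, one_smul, h₄]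

/-- The real part suffices: it is applied with `x = y`, where it is `‖y‖ ^ 2`. -/
theorem ip_left_eq_zero_of_mem_closure_sliceSpan {i : ℍ} {s : Set H} {y : H}
    (h : ∀ x ∈ s, ip x y = 0) {x : H} (hx : x ∈ closure (sliceSpan i s)) : (ip x y).re = 0 := by
  refine closure_minimal (t := {x : H | (ip x y).re = 0}) ?_
    (isClosed_singleton.preimage (continuous_re_ip_left y)) hx
  intro x hx
  refine congrArg QuaternionAlgebra.re (?_ : ip x y = 0)
  refine AddSubgroup.closure_induction (p := fun x _ => ip x y = 0) ?_ ?_ ?_ ?_ hx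
  · rintro _ ⟨x, hx, a, -, rfl⟩
    rw [ip_smul_left, h x hx, mul_zero]
  · rw [ip_star, ip_zero, star_zero]
  · intro a b _ _ ha hb
    rw [ip_add_left, ha, hb, add_zero]
  · intro a _ ha
    have := ip_smul_left a y (-1)
    simpa [ha] using this

end CommutingOperators

/-! ### The sesqui-holomorphic symbol of an operator and its vanishing. -/

section Berezin

variable {H : Type*} [NormedAddCommGroup H] [Module ℍᵐᵒᵖ H] [QuaternionicHilbertSpace H]
  [SliceRKHS H]

open QuaternionicHilbertSpace SliceRKHS ComplexConjugate

/-- The kernel function at the point `sliceEmb i z` of the ball (and `0` outside of the ball). -/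
noncomputable def sliceKernel (H : Type*) [NormedAddCommGroup H] [Module ℍᵐᵒᵖ H]
    [QuaternionicHilbertSpace H] [SliceRKHS H] (i : ℍ) (z : ℂ) : H :=
  open Classical in if h : sliceEmb i z ∈ unitBall then kernelFun H ⟨sliceEmb i z, h⟩ else 0

theorem sliceKernel_of_mem {i : ℍ} {z : ℂ} (h : sliceEmb i z ∈ unitBall) :
    sliceKernel H i z = kernelFun H ⟨sliceEmb i z, h⟩ := dif_pos h

theorem differentiableOn_sliceProj_ip_sliceKernel {i : ℍ} (hi : i ∈ imagUnits) (f : H) :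
    DifferentiableOn ℂ (fun z => sliceProj i (ip (sliceKernel H i z) f)) (Metric.ball 0 1) :=
  (slice f).differentiableOn_slice hi fun z h => by
    rw [sliceKernel_of_mem h, eval_eq_ip]

theorem exists_norm_sliceKernel_le {i : ℍ} (hi : i ∈ imagUnits) :
    ∃ C : ℝ, 0 ≤ C ∧ ∀ z ∈ Metric.ball (0 : ℂ) (1 / 2), ‖sliceKernel H i z‖ ≤ C := by
  have hs : IsCompact ((↑) ⁻¹' Metric.closedBall (0 : ℍ) (1 / 2) : Set unitBall) := by
    rw [Topology.IsInducing.subtypeVal.isCompact_preimage_iff]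
    · exact isCompact_closedBall _ _
    · rw [Subtype.range_coe]
      exact Metric.closedBall_subset_ball (by norm_num)
  obtain ⟨C, hC0, hC⟩ := exists_norm_kernelFun_le (H := H) hs
  refine ⟨C, hC0, fun z hz => ?_⟩
  have hz1 : z ∈ Metric.ball (0 : ℂ) 1 := Metric.ball_subset_ball (by norm_num) hz
  rw [sliceKernel_of_mem ((sliceEmb_mem_unitBall hi).2 hz1)]
  refine hC _ ?_
  rw [Set.mem_preimage, mem_closedBall_zero_iff, norm_sliceEmb hi]
  exact (mem_ball_zero_iff.1 hz).le

/-- A bounded operator with vanishing Berezin transform on `𝔻_i` has vanishing `ℂ_i`-part of its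
sesqui-holomorphic symbol `⟨K_w, A K_q⟩`. -/
theorem sliceProj_ip_sliceKernel_eq_zero {i : ℍ} (hi : i ∈ imagUnits) (A : H →L[ℍᵐᵒᵖ] H)
    (hA : ∀ z ∈ Metric.ball (0 : ℂ) 1, ip (sliceKernel H i z) (A (sliceKernel H i z)) = 0) :
    ∀ z ∈ Metric.ball (0 : ℂ) 1, ∀ w ∈ Metric.ball (0 : ℂ) 1,
      sliceProj i (ip (sliceKernel H i z) (A (sliceKernel H i w))) = 0 := by
  obtain ⟨C, hC0, hC⟩ := exists_norm_sliceKernel_le (H := H) hi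
  obtain ⟨D, hD0, hD⟩ := exists_bound_apply A
  have hconj : ∀ {r : ℝ} {w : ℂ}, w ∈ Metric.ball (0 : ℂ) r → conj w ∈ Metric.ball (0 : ℂ) r :=
    fun hw => by simpa using hw
  have main := eq_zero_of_antidiagonal (r := 1) (R := 1 / 2) (M := ‖sliceProj i‖ * (C * (D * C)))
    (f := fun z w => sliceProj i (ip (sliceKernel H i z) (A (sliceKernel H i (conj w)))))
    (by norm_num) (by norm_num)
    (fun w _ => differentiableOn_sliceProj_ip_sliceKernel hi _)
    (fun z _ w hw => ?_) (fun z hz w hw => ?_) (fun z hz => ?_)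
  · intro z hz w hw
    simpa using main z hz (conj w) (hconj hw)
  -- With `G = A* K_z`, the symbol is the conjugate of the slice of `G` at `conj w`, hence
  -- holomorphic in `w`.
  · obtain ⟨G, hG⟩ := exists_adjoint_apply A (sliceKernel H i z)
    have hd := ((differentiableOn_sliceProj_ip_sliceKernel hi G).differentiableAt
      (Metric.isOpen_ball.mem_nhds (hconj hw))).conj_conj
    rw [Complex.conj_conj] at hd
    refine (hd.congr_of_eventuallyEq (.of_forall fun w => ?_)).differentiableWithinAt
    rw [hG, ip_star, sliceProj_star hi]
    rfl
  · refine (sliceProj i).le_opNorm_of_le ((norm_ip_le _ _).trans ?_)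
    have := (hD (sliceKernel H i (conj w))).trans
      (mul_le_mul_of_nonneg_left (hC _ (hconj hw)) hD0)
    exact mul_le_mul (hC z hz) this (norm_nonneg _) hC0
  · rw [Complex.conj_conj, hA z (Metric.ball_subset_ball (by norm_num) hz), map_zero]

/-- A bounded operator commuting with `J` is zero if `⟨K_q, A K_q⟩ = 0` for all `q ∈ 𝔻_i`. -/
theorem eq_zero_of_ip_kernelFun_eq_zero {i : ℍ} (hi : i ∈ imagUnits) {J : H →L[ℍᵐᵒᵖ] H}
    (hJa : IsAntiSelfAdjoint J) (hJu : IsUnitary J)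
    (hJ : plusSpace J i = closure (sliceSpan i (kernelFun H '' sliceDisc i)))
    {A : H →L[ℍᵐᵒᵖ] H} (hAJ : A.comp J = J.comp A)
    (hA : ∀ q ∈ sliceDisc i, ip (kernelFun H q) (A (kernelFun H q)) = 0) (x : H) : A x = 0 := by
  have hemb : ∀ q ∈ sliceDisc i, ∃ z ∈ Metric.ball (0 : ℂ) 1,
      sliceKernel H i z = kernelFun H q := by
    rintro ⟨q, hq⟩ ⟨a, b, hab⟩
    have e : sliceEmb i ⟨a, b⟩ = q := hab.symm
    subst e
    exact ⟨_, (sliceEmb_mem_unitBall hi).1 hq, sliceKernel_of_mem hq⟩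
  have hmem : ∀ q ∈ sliceDisc i, kernelFun H q ∈ plusSpace J i := fun q hq =>
    hJ ▸ subset_closure_sliceSpan i _ (Set.mem_image_of_mem _ hq)
  have hsymb := sliceProj_ip_sliceKernel_eq_zero hi A fun z hz => by
    have hz' := (sliceEmb_mem_unitBall hi).2 hz
    rw [sliceKernel_of_mem hz']
    exact hA _ ⟨z.re, z.im, rfl⟩
  have hker : ∀ q ∈ sliceDisc i, A (kernelFun H q) = 0 := fun q hq => by
    have hAq := map_mem_plusSpace hAJ (hmem q hq)
    have horth : ∀ y ∈ kernelFun H '' sliceDisc i, ip y (A (kernelFun H q)) = 0 := by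
      rintro _ ⟨w, hw, rfl⟩
      refine eq_zero_of_sliceProj_eq_zero hi
        (commute_ip_of_mem_plusSpace hJa hi (hmem w hw) hAq) ?_
      obtain ⟨z, hz, ez⟩ := hemb w hw
      obtain ⟨z', hz', ez'⟩ := hemb q hq
      rw [← ez, ← ez']
      exact hsymb z hz z' hz'
    -- `A K_q` lies in the closed span of the vectors it is orthogonal to, so it is orthogonal to
    -- itself.
    have := ip_left_eq_zero_of_mem_closure_sliceSpan horth (hJ ▸ hAq)
    rw [← norm_sq_eq] at this
    simpa using this
  refine eq_zero_of_eqOn_plusSpace hJa hJu hi (fun y hy => ?_) x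
  refine map_eq_zero_of_mem_closure_sliceSpan (i := i) (s := kernelFun H '' sliceDisc i) ?_
    (hJ ▸ hy)
  rintro _ ⟨q, hq, rfl⟩
  exact hker q hq

end Berezin

end QuaternionicBerezin

theorem mainTheorem11 {H : Type*} [NormedAddCommGroup H] [Module ℍᵐᵒᵖ H]
    [QuaternionicHilbertSpace H] [SliceRKHS H]
    (hne : ∀ q : unitBall, ∃ f : H, SliceRKHS.eval f q ≠ 0)
    (i : ℍ) (hi : i ∈ imagUnits)
    (J : H →L[ℍᵐᵒᵖ] H) (hJa : IsAntiSelfAdjoint J) (hJu : IsUnitary J)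
    (hJ : plusSpace J i = closure (sliceSpan i (kernelFun H '' sliceDisc i))) :
    Set.InjOn (fun T : H →L[ℍᵐᵒᵖ] H => berezin i T) (commutingOperators J) := by
  intro T hT S hS hTS
  have hT' : T.comp J = J.comp T := hT
  have hS' : S.comp J = J.comp S := hS
  ext x
  rw [← sub_eq_zero]
  refine eq_zero_of_ip_kernelFun_eq_zero (A := T - S) hi hJa hJu hJ ?_ (fun q hq => ?_) x
  · rw [ContinuousLinearMap.sub_comp, ContinuousLinearMap.comp_sub, hT', hS']
  · have h := ip_kernelFun_eq_of_normalizedKernel (hne q) (congrFun hTS ⟨q, hq⟩)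
    have e : T (kernelFun H q) = (T - S) (kernelFun H q) + S (kernelFun H q) := by simp
    rw [e, ip_add] at h
    simpa using h
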